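/- Let $R$ be a commutative Noetherian local ring with maximal ideal $\mathfrak{m}$, and assume that $R$ is reduced, has Krull dimension one, and is not regular. Then for every integer $t \geq 1$ the $R$-module $\mathfrak{m}^t \otimes_R \operatorname{Hom}_R(\mathfrak{m}^t, R)$ has nonzero torsion; that is, it contains a nonzero element annihilated by some non-zero-divisor of $R$. (In other words, each $M = \mathfrak{m}^t$ with $t \geq 1$ satisfies the torsion condition of the Huneke–Wiegand conjecture: $M \otimes_R \operatorname{Hom}_R(M,R)$ has nonzero torsion.) -/

import Mathlib

open scoped TensorProduct

open IsLocalRing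

section

variable {R : Type*} [CommRing R]

/-! Put `I = m^(s+1)` and `N = Hom(I, R)`. If `I ⊗ N` is torsion-free, then `I ⊗ N → R ⊗ N` is
injective, i.e. `Tor₁(R/I, N) = 0`. For a power of `m`, Nakayama applied to the syzygy of a minimal
cover turns this vanishing into freeness of `N`. A free dual has rank one, and in dimension one this
forces `I` to be principal. Then `m` is principal too, so `R` is regular, a contradiction. -/

theorem Ideal.rTensor_subtype_injective_of_torsion_eq_bot {N : Type*} [AddCommGroup N] [Module R N]
    {I : Ideal R} {y : R} (hyI : y ∈ I) (hy : y ∈ nonZeroDivisors R)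
    (h : Submodule.torsion R (I ⊗[R] N) = ⊥) :
    Function.Injective (I.subtype.rTensor N) := by
  rw [injective_iff_map_eq_zero]
  intro z hz
  let g : R →ₗ[R] I := LinearMap.toSpanSingleton R I ⟨y, hyI⟩
  -- Since `y ∈ I`, multiplication by `y` on `I` factors through the inclusion into `R`, so `y`
  -- kills the kernel after tensoring.
  have hg : g ∘ₗ I.subtype = y • LinearMap.id := by
    ext a
    simp [g, mul_comm]
  have hyz : y • z = 0 := by
    have := congrArg (g.rTensor N) hz
    rw [← LinearMap.comp_apply, ← LinearMap.rTensor_comp, hg, LinearMap.rTensor_smul] at this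
    simpa using this
  have hmem : z ∈ Submodule.torsion R (I ⊗[R] N) :=
    (Submodule.mem_torsion_iff z).2 ⟨⟨y, hy⟩, hyz⟩
  simpa [h] using hmem

/-- Lift an element of `ker p ∩ IF` to `I ⊗ F`. By injectivity its image in `I ⊗ N` vanishes, so
right exactness brings the lift from `I ⊗ ker p`. -/
theorem Ideal.ker_inf_smul_top_le_of_rTensor_subtype_injective
    {F N : Type*} [AddCommGroup F] [Module R F] [Module.Flat R F] [AddCommGroup N] [Module R N]
    {I : Ideal R} (p : F →ₗ[R] N) (hp : Function.Surjective p)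
    (h : Function.Injective (I.subtype.rTensor N)) :
    LinearMap.ker p ⊓ I • (⊤ : Submodule R F) ≤ I • LinearMap.ker p := by
  rintro z ⟨hzK, hzI⟩
  let toF : (I ⊗[R] F) →ₗ[R] F := (TensorProduct.lid R F).toLinearMap ∘ₗ I.subtype.rTensor F
  have toF_tmul : ∀ (a : I) (x : F), toF (a ⊗ₜ x) = (a : R) • x := fun a x ↦ by simp [toF]
  obtain ⟨w, rfl⟩ : ∃ w, toF w = z := by
    refine Submodule.smul_induction_on hzI (fun a ha x _ ↦ ⟨⟨a, ha⟩ ⊗ₜ x, toF_tmul _ _⟩) ?_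
    rintro _ _ ⟨u, rfl⟩ ⟨v, rfl⟩
    exact ⟨u + v, map_add _ _ _⟩
  have hw : p.lTensor I w = 0 := by
    apply h
    apply (TensorProduct.lid R N).injective
    have : (TensorProduct.lid R N).toLinearMap ∘ₗ I.subtype.rTensor N ∘ₗ p.lTensor I
        = p ∘ₗ toF := by
      ext a x
      simp [toF]
    exact ((LinearMap.congr_fun this w).trans hzK).trans (map_zero _).symm
  obtain ⟨u, rfl⟩ := (lTensor_exact I (LinearMap.exact_subtype_ker_map p) hp w).1 hw
  clear hw hzK hzI
  induction u with
  | zero => simp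
  | tmul a x =>
    rw [LinearMap.lTensor_tmul, toF_tmul]
    exact Submodule.smul_mem_smul a.2 x.2
  | add u v hu hv =>
    rw [map_add, map_add]
    exact add_mem hu hv

variable [IsLocalRing R]

theorem IsLocalRing.exists_surjective_finsupp_ker_le_smul_top (N : Type*) [AddCommGroup N]
    [Module R N] [Module.Finite R N] :
    ∃ (n : ℕ) (p : (Fin n →₀ R) →ₗ[R] N), Function.Surjective p ∧
      LinearMap.ker p ≤ maximalIdeal R • ⊤ := by
  let bk := Module.finBasis (ResidueField R) (ResidueField R ⊗[R] N)
  have hsurj : Function.Surjective (TensorProduct.mk R (ResidueField R) N 1) :=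
    TensorProduct.mk_surjective R N (ResidueField R) IsLocalRing.residue_surjective
  choose v hv using fun i ↦ hsurj (bk i)
  refine ⟨_, Finsupp.linearCombination R v, ?_, ?_⟩
  · rw [← LinearMap.range_eq_top, Finsupp.range_linearCombination]
    exact span_eq_top_of_tmul_eq_basis v bk hv
  · intro c hc
    have h0 : ∑ i, residue R (c i) • bk i = 0 := by
      have := congrArg (TensorProduct.mk R (ResidueField R) N 1) (LinearMap.mem_ker.1 hc)
      rw [Finsupp.linearCombination_apply, Finsupp.sum_fintype _ _ (by simp), map_sum,
        map_zero] at this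
      rw [← this]
      refine Finset.sum_congr rfl fun i _ ↦ ?_
      rw [map_smul, hv]
      exact algebraMap_smul (ResidueField R) (c i) (bk i)
    have hc' : ∀ i, c i ∈ maximalIdeal R := fun i ↦
      (residue_eq_zero_iff _).1 (Fintype.linearIndependent_iff.1 bk.linearIndependent _ h0 i)
    rw [← c.sum_single, Finsupp.sum]
    refine Submodule.sum_mem _ fun i _ ↦ ?_
    have : Finsupp.single i (c i) = c i • Finsupp.single i (1 : R) := by simp
    rw [this]
    exact Submodule.smul_mem_smul (hc' i) trivial

/-- A minimal cover `F → N` has kernel `K ⊆ mF`, so `m^s K ⊆ K ∩ m^(s+1) F ⊆ m^(s+1) K`. Nakayama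
gives `m^s K = 0`, and `y^s` is regular on `F`, hence `K = 0`. -/
theorem IsLocalRing.free_of_maximalIdeal_pow_rTensor_injective [IsNoetherianRing R]
    {N : Type*} [AddCommGroup N] [Module R N] [Module.Finite R N]
    {y : R} (hym : y ∈ maximalIdeal R) (hy : y ∈ nonZeroDivisors R) (s : ℕ)
    (h : Function.Injective ((maximalIdeal R ^ (s + 1)).subtype.rTensor N)) :
    ∃ n : ℕ, Nonempty (Module.Basis (Fin n) R N) := by
  obtain ⟨n, p, hp, hker⟩ := exists_surjective_finsupp_ker_le_smul_top (R := R) N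
  have hle : maximalIdeal R ^ s • LinearMap.ker p ≤
      maximalIdeal R • (maximalIdeal R ^ s • LinearMap.ker p) := by
    rw [← Submodule.mul_smul, ← pow_succ']
    refine le_trans (le_inf Submodule.smul_le_right ?_)
      (Ideal.ker_inf_smul_top_le_of_rTensor_subtype_injective p hp h)
    rw [pow_succ, Submodule.mul_smul]
    exact Submodule.smul_mono le_rfl hker
  have hbot : maximalIdeal R ^ s • LinearMap.ker p = ⊥ :=
    Submodule.eq_bot_of_le_smul_of_le_jacobson_bot _ _ (IsNoetherian.noetherian _) hle
      (maximalIdeal_le_jacobson _)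
  have hinj : Function.Injective p := by
    rw [injective_iff_map_eq_zero]
    intro c hc
    have hyc : y ^ s • c = 0 := by
      have := Submodule.smul_mem_smul (Ideal.pow_mem_pow hym s) (LinearMap.mem_ker.2 hc)
      rwa [hbot, Submodule.mem_bot] at this
    ext i
    have := DFunLike.congr_fun hyc i
    simpa using (mul_left_mem_nonZeroDivisors_eq_zero_iff (pow_mem hy s)).1 this
  exact ⟨n, ⟨.ofRepr (LinearEquiv.ofBijective p ⟨hinj, hp⟩).symm⟩⟩

/-- Otherwise prime avoidance makes `m` the annihilator of some `x ≠ 0`. As `R` is not a field, `x ∈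
m`, so `x² = 0`, contradicting reducedness. -/
theorem IsLocalRing.exists_mem_maximalIdeal_mem_nonZeroDivisors [IsNoetherianRing R] [IsReduced R]
    (hR : ¬ IsField R) : ∃ y ∈ maximalIdeal R, y ∈ nonZeroDivisors R := by
  by_contra! hcon
  have hsub : (maximalIdeal R : Set R) ⊆ ⋃ p ∈ associatedPrimes R R, (p : Set R) := by
    rw [biUnion_associatedPrimes_eq_compl_nonZeroDivisors]
    exact hcon
  have hfin := associatedPrimes.finite R R
  obtain ⟨p, hp, hle⟩ := (Ideal.subset_union_prime_finite hfin (f := id) 0 0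
    fun p hp _ _ ↦ IsAssociatedPrime.isPrime hp).1 hsub
  have hpm : p = maximalIdeal R :=
    le_antisymm (le_maximalIdeal (IsAssociatedPrime.isPrime hp).ne_top) hle
  obtain ⟨hprime, x, hx⟩ := isAssociatedPrime_iff.1 hp
  have hmx : ∀ a, a ∈ maximalIdeal R ↔ a * x = 0 := fun a ↦ by
    rw [← hpm, hx, Submodule.mem_colon_singleton, Submodule.mem_bot, smul_eq_mul]
  have hx0 : x ≠ 0 := fun h ↦
    (Ideal.ne_top_iff_one _).1 (maximalIdeal.isMaximal R).ne_top ((hmx 1).2 (by simp [h]))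
  have hxm : x ∈ maximalIdeal R := by
    rw [mem_maximalIdeal, mem_nonunits_iff]
    intro hxu
    refine hR ((isField_iff_maximalIdeal_eq).2 ((Submodule.eq_bot_iff _).2 fun a ha ↦ ?_))
    exact hxu.mul_left_eq_zero.1 ((hmx a).1 ha)
  exact hx0 (IsReduced.eq_zero x ⟨2, by rw [pow_two, (hmx x).1 hxm]⟩)

/-- `R/(y)` has dimension zero, so it has a nonzero socle: take the last power of `m` not inside
`(y)`. -/
theorem IsLocalRing.exists_notMem_span_mul_maximalIdeal_le [IsNoetherianRing R]
    (hdim : ringKrullDim R ≤ 1) {y : R} (hym : y ∈ maximalIdeal R) (hy : y ∈ nonZeroDivisors R) :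
    ∃ b ∉ Ideal.span {y}, ∀ a ∈ maximalIdeal R, b * a ∈ Ideal.span {y} := by
  have hquot : Ring.KrullDimLE 0 (R ⧸ Ideal.span {y}) := by
    rw [Ring.krullDimLE_iff]
    have := (ringKrullDim_quotient_succ_le_of_nonZeroDivisor hy).trans hdim
    exact ENat.WithBot.add_le_add_natCast_right_iff.mp this
  have hrad : maximalIdeal R ≤ (Ideal.span {y}).radical := by
    rw [← Ideal.sInf_minimalPrimes]
    refine le_sInf fun p hp ↦ (eq_maximalIdeal ?_).ge
    exact Ideal.krullDimLE_zero_quotient_iff_forall_minimalPrimes_isMaximal.1 hquot p hp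
  obtain ⟨n, hn⟩ := Ideal.exists_radical_pow_le_of_fg (Ideal.span {y})
    (IsNoetherian.noetherian _)
  replace hn := (Ideal.pow_right_mono hrad n).trans hn
  classical
  have hex : ∃ n, maximalIdeal R ^ n ≤ Ideal.span {y} := ⟨n, hn⟩
  obtain ⟨k, hk⟩ : ∃ k, Nat.find hex = k + 1 := by
    refine Nat.exists_eq_succ_of_ne_zero fun h0 ↦ ?_
    have := Nat.find_spec hex
    rw [h0, pow_zero, Ideal.one_eq_top, top_le_iff, Ideal.span_singleton_eq_top] at this
    exact (mem_maximalIdeal y).1 hym this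
  obtain ⟨b, hb, hby⟩ := SetLike.not_le_iff_exists.1 (Nat.find_min hex (by omega : k < _))
  refine ⟨b, hby, fun a ha ↦ ?_⟩
  have := Nat.find_spec hex
  rw [hk, pow_succ] at this
  exact this (Ideal.mul_mem_mul hb ha)

theorem IsLocalRing.exists_maximalIdeal_eq_span_singleton_of_pow {s : ℕ} {r : R}
    (hr : r ∈ nonZeroDivisors R) (h : maximalIdeal R ^ (s + 1) = Ideal.span {r}) :
    ∃ a, maximalIdeal R = Ideal.span {a} := by
  -- Some product must generate `(r)`: otherwise `(r) ⊆ r m`, and cancelling `r` puts `1` in `m`.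
  -- Cancelling `b` later shows that `a` generates `m`.
  obtain ⟨a, ha, b, hb, u, hu⟩ : ∃ a ∈ maximalIdeal R, ∃ b ∈ maximalIdeal R ^ s,
      ∃ u : Rˣ, a * b = r * u := by
    by_contra! hcon
    have hle : maximalIdeal R * maximalIdeal R ^ s ≤ Ideal.span {r} * maximalIdeal R := by
      refine Ideal.mul_le.2 fun a ha b hb ↦ ?_
      have : a * b ∈ Ideal.span {r} := h ▸ pow_succ' (maximalIdeal R) s ▸ Ideal.mul_mem_mul ha hb
      obtain ⟨c, hc⟩ := Ideal.mem_span_singleton'.1 this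
      rw [← hc, mul_comm c r]
      refine Ideal.mul_mem_mul (Ideal.mem_span_singleton_self r) ((mem_maximalIdeal c).2 ?_)
      rintro ⟨u, rfl⟩
      exact hcon a ha b hb u (by rw [← hc, mul_comm])
    rw [← pow_succ', h] at hle
    obtain ⟨c, hc, hrc⟩ := Ideal.mem_span_singleton_mul.1 (hle (Ideal.mem_span_singleton_self r))
    have : r * (c - 1) = 0 := by rw [mul_sub, hrc]; ring
    have := (mul_left_mem_nonZeroDivisors_eq_zero_iff hr).1 this
    exact (Ideal.ne_top_iff_one _).1 (maximalIdeal.isMaximal R).ne_top (sub_eq_zero.1 this ▸ hc)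
  have hab : a * b ∈ nonZeroDivisors R := hu ▸ mul_mem hr u.isUnit.mem_nonZeroDivisors
  refine ⟨a, le_antisymm (fun x hx ↦ ?_) ((Ideal.span_singleton_le_iff_mem _).2 ha)⟩
  have hxb : x * b ∈ Ideal.span {r} := h ▸ pow_succ' (maximalIdeal R) s ▸ Ideal.mul_mem_mul hx hb
  obtain ⟨c, hc⟩ := Ideal.mem_span_singleton'.1 hxb
  refine Ideal.mem_span_singleton'.2 ⟨c * ↑u⁻¹, ?_⟩
  have hb' : b ∈ nonZeroDivisors R := (mul_mem_nonZeroDivisors.1 hab).2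
  refine (mul_cancel_right_mem_nonZeroDivisors hb').1 ?_
  calc c * ↑u⁻¹ * a * b = c * ↑u⁻¹ * (a * b) := by ring
    _ = c * r * (↑u⁻¹ * u) := by rw [hu]; ring
    _ = x * b := by rw [u.inv_mul, mul_one, hc]

/-- Any two functionals on an ideal are proportional, so a free dual has rank one. -/
theorem Ideal.exists_dual_generator {I : Ideal R} {y : R} (hyI : y ∈ I)
    (hy : y ∈ nonZeroDivisors R) {n : ℕ} (b : Module.Basis (Fin n) R (I →ₗ[R] R)) :
    ∃ φ : I →ₗ[R] R, (∀ ψ : I →ₗ[R] R, ∃ c : R, ψ = c • φ) ∧ ∀ c : R, c • φ = 0 → c = 0 := by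
  have hsymm : ∀ (φ : I →ₗ[R] R) (a c : I), φ a * c = φ c * a := fun φ a c ↦ by
    have h1 : φ ((c : R) • a) = φ ((a : R) • c) := congrArg φ (Subtype.ext (mul_comm _ _))
    simp only [map_smul, smul_eq_mul] at h1
    rw [mul_comm, h1, mul_comm]
  have hne : ∀ φ : I →ₗ[R] R, φ ⟨y, hyI⟩ = 0 → φ = 0 := fun φ hφ ↦ by
    ext a
    have := hsymm φ a ⟨y, hyI⟩
    rw [hφ, zero_mul] at this
    exact (mul_right_mem_nonZeroDivisors_eq_zero_iff hy).1 this
  have hcomm : ∀ φ ψ : I →ₗ[R] R, φ ⟨y, hyI⟩ • ψ = ψ ⟨y, hyI⟩ • φ := fun φ ψ ↦ by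
    ext a
    simp only [LinearMap.smul_apply, smul_eq_mul]
    refine (mul_cancel_right_mem_nonZeroDivisors hy).1 ?_
    linear_combination φ ⟨y, hyI⟩ * hsymm ψ a ⟨y, hyI⟩ - ψ ⟨y, hyI⟩ * hsymm φ a ⟨y, hyI⟩
  have hsub : Subsingleton (Fin n) := ⟨fun i j ↦ by
    by_contra hij
    -- The `j`-th coordinate of the proportionality relation reads `b i y = 0`.
    have h1 := congrArg (fun ψ ↦ b.repr ψ j) (hcomm (b i) (b j))
    simp [hij] at h1
    exact b.ne_zero i (hne _ h1)⟩
  have hι : I.subtype ≠ 0 := fun h ↦ by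
    have : y = 0 := LinearMap.congr_fun h ⟨y, hyI⟩
    exact nonZeroDivisors.ne_zero hy this
  obtain ⟨i⟩ : Nonempty (Fin n) := by
    by_contra hemp
    rw [not_nonempty_iff] at hemp
    exact hι (b.repr.injective (Subsingleton.elim _ _))
  refine ⟨b i, fun ψ ↦ ⟨b.repr ψ i, ?_⟩, fun c hc ↦ ?_⟩
  · have := Fintype.sum_subsingleton (fun j ↦ b.repr ψ j • b j) i
    rw [← this, b.sum_repr]
  · have := congrArg (fun ψ ↦ b.repr ψ i) hc
    simpa using this

theorem Ideal.exists_eq_span_singleton_of_basis_dual [IsNoetherianRing R]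
    (hdim : ringKrullDim R ≤ 1) {I : Ideal R} {y : R} (hyI : y ∈ I) (hym : y ∈ maximalIdeal R)
    (hy : y ∈ nonZeroDivisors R) {n : ℕ} (b : Module.Basis (Fin n) R (I →ₗ[R] R)) :
    ∃ r ∈ nonZeroDivisors R, I = Ideal.span {r} := by
  obtain ⟨φ, hgen, hfree⟩ := Ideal.exists_dual_generator hyI hy b
  obtain ⟨r, hr⟩ := hgen I.subtype
  have hrφ : ∀ a : I, (a : R) = r * φ a := LinearMap.congr_fun hr
  have hr0 : r ∈ nonZeroDivisors R := by
    have hyr : y = r * φ ⟨y, hyI⟩ := hrφ ⟨y, hyI⟩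
    rw [hyr] at hy
    exact (mul_mem_nonZeroDivisors.1 hy).1
  -- If `φ` took values in `m`, a socle element `c` modulo `y` would give a functional `(c/y)φ`. It
  -- equals some `sφ`, whence `c = ys ∈ (y)`, which is excluded.
  obtain ⟨a₀, ha₀⟩ : ∃ a, IsUnit (φ a) := by
    by_contra! hcon
    obtain ⟨c, hcy, hc⟩ := exists_notMem_span_mul_maximalIdeal_le hdim hym hy
    have hdvd : ∀ a, ∃ d, c * φ a = y * d := fun a ↦
      Ideal.mem_span_singleton.1 (hc (φ a) ((mem_maximalIdeal _).2 (hcon a)))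
    choose d hd using hdvd
    let ψ : I →ₗ[R] R :=
      { toFun := d
        map_add' := fun a a' ↦ (mul_cancel_left_mem_nonZeroDivisors hy).1 (by
          rw [mul_add, ← hd, ← hd, ← hd, map_add, mul_add])
        map_smul' := fun s a ↦ (mul_cancel_left_mem_nonZeroDivisors hy).1 (by
          simp only [RingHom.id_apply, smul_eq_mul]
          rw [mul_left_comm, ← hd, ← hd, map_smul, smul_eq_mul, mul_left_comm]) }
    obtain ⟨s, hs⟩ := hgen ψ
    have : c - y * s = 0 := hfree _ <| by
      ext a
      have h1 : d a = s * φ a := LinearMap.congr_fun hs a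
      simp only [LinearMap.smul_apply, smul_eq_mul, LinearMap.zero_apply]
      rw [sub_mul, hd, h1]
      ring
    exact hcy (Ideal.mem_span_singleton.2 ⟨s, sub_eq_zero.1 this⟩)
  refine ⟨r, hr0, le_antisymm (fun a ha ↦ ?_) ((Ideal.span_singleton_le_iff_mem _).2 ?_)⟩
  · exact Ideal.mem_span_singleton.2 ⟨_, hrφ ⟨a, ha⟩⟩
  · obtain ⟨u, hu⟩ := ha₀
    have : r = ↑u⁻¹ * (a₀ : R) := by
      rw [hrφ a₀, ← hu, mul_left_comm, u.inv_mul, mul_one]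
    rw [this]
    exact I.mul_mem_left _ a₀.2

end

theorem corollary1p5 {R : Type*} [CommRing R] [IsNoetherianRing R] [IsLocalRing R]
    [IsReduced R] (hdim : ringKrullDim R = 1) (hreg : ¬ IsRegularLocalRing R)
    (t : ℕ) (ht : 1 ≤ t) :
    Submodule.torsion R
      (↥(IsLocalRing.maximalIdeal R ^ t) ⊗[R]
        (↥(IsLocalRing.maximalIdeal R ^ t) →ₗ[R] R)) ≠ ⊥ := by
  intro htor
  obtain ⟨s, rfl⟩ := Nat.exists_eq_add_of_le' ht
  have hfield : ¬ IsField R := fun h ↦ by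
    rw [ringKrullDim_eq_zero_of_isField h] at hdim
    exact zero_ne_one hdim
  obtain ⟨y, hym, hy⟩ := exists_mem_maximalIdeal_mem_nonZeroDivisors hfield
  have hyI := Ideal.pow_mem_pow hym (s + 1)
  have hyn := pow_mem hy (s + 1)
  obtain ⟨n, ⟨b⟩⟩ := free_of_maximalIdeal_pow_rTensor_injective hym hy s
    (Ideal.rTensor_subtype_injective_of_torsion_eq_bot hyI hyn htor)
  obtain ⟨r, hr, hI⟩ := Ideal.exists_eq_span_singleton_of_basis_dual hdim.le hyI
    (Ideal.pow_le_self s.succ_ne_zero hyI) hyn b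
  obtain ⟨a, ha⟩ := exists_maximalIdeal_eq_span_singleton_of_pow hr hI
  refine hreg (IsRegularLocalRing.of_spanFinrank_maximalIdeal_le R ?_)
  have hle := Submodule.spanFinrank_span_le_ncard_of_finite (R := R) (Set.finite_singleton a)
  rw [Set.ncard_singleton] at hle
  rw [hdim, ha]
  exact_mod_cast hle
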